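/- Let $G$ be a finite simple connected graph of order $n$ and diameter $d\ge 2$. For a finite connected graph $H$ let $\xi^c(H)=\sum_{v\in V(H)}\epsilon(v)\,\mathrm{d}(v)$ be its eccentric connectivity index, where $\epsilon(v)$ is the eccentricity and $\mathrm{d}(v)$ the degree of $v$ in $H$. A volcano graph $V_{n,d}$ is any graph obtained from a path $P_{d+1}$ on $d+1$ vertices and a set $S$ of $n-d-1$ further vertices by joining each vertex of $S$ to exactly one central vertex of $P_{d+1}$, that is, to a vertex of minimum eccentricity in $P_{d+1}$ (there is one such vertex if $d$ is even and there are two if $d$ is odd; in the latter case different vertices of $S$ may be joined to different central vertices). Then $$\xi^c(G)\ \ge\ \xi^c(V_{n,d})$$ for every volcano graph $V_{n,d}$. -/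

import Mathlib

/-- The eccentric connectivity index: the sum over all vertices of eccentricity times degree.
(In a finite connected graph every eccentricity is finite, so `ENat.toNat` loses nothing.) -/
noncomputable def eccentricConnectivityIndex {V : Type*} [Fintype V] (G : SimpleGraph V) : ℕ :=
  open scoped Classical in ∑ v : V, (G.eccent v).toNat * G.degree v

/-- The volcano graph obtained from the path on the `d + 1` vertices `Sum.inl 0, …, Sum.inl d`
and the set of `m` further vertices `Sum.inr 0, …, Sum.inr (m - 1)`, where the further vertex
`Sum.inr s` is joined to the central vertex `c s` of the path and to nothing else.
It has `d + 1 + m` vertices; a path has one central vertex when `d` is even and two when `d` is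
odd, in which case different choices of `c` may give non-isomorphic graphs. -/
def volcanoGraph (d m : ℕ) (c : Fin m → (SimpleGraph.pathGraph (d + 1)).center) :
    SimpleGraph (Fin (d + 1) ⊕ Fin m) :=
  SimpleGraph.fromRel fun x y =>
    match x, y with
    | Sum.inl i, Sum.inl j => (SimpleGraph.pathGraph (d + 1)).Adj i j
    | Sum.inl i, Sum.inr s => (c s : Fin (d + 1)) = i
    | Sum.inr _, _ => False

/-! ### Lower bound for an arbitrary graph -/

namespace SimpleGraph

variable {V : Type*}

/-! Write the index as the sum over darts of the eccentricity of the start, and put r = ⌈d/2⌉. Take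
s, t at distance d and a breadth-first tree rooted at s. Its branch from s to t costs at least what
the path costs in a volcano. Every eccentricity is at least r, so the tree edge from any other
vertex v to its parent costs at least 2r + 1, the cost of a pendant edge of a volcano, unless v has
eccentricity r, when it may fall short by 1. The non-tree darts cost at least r each, and
`card_le_mul_card_nontree_darts` shows that this covers the total shortfall. A volcano attains at
most the resulting bound, which needs only upper bounds on its eccentricities. -/

lemma Connected.exists_adj_dist_add_one {G : SimpleGraph V} (hG : G.Connected) {u v : V}
    (h : u ≠ v) : ∃ w, G.Adj v w ∧ G.dist u w + 1 = G.dist u v := by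
  obtain ⟨p, hp⟩ := hG.exists_walk_length_eq_dist v u
  cases p with
  | nil => exact absurd rfl h
  | @cons _ w _ hvw p =>
    refine ⟨w, hvw, ?_⟩
    have h1 := dist_le p
    have h2 := hG.dist_triangle (u := v) (v := w) (w := u)
    have h3 : G.dist v w = 1 := dist_eq_one_iff_adj.2 hvw
    rw [Walk.length_cons] at hp
    rw [dist_comm (u := u) (v := w), dist_comm (u := u) (v := v)]
    omega

/-- Connectedness and finiteness exclude the eccentricity `⊤`, which `toNat` would send to 0. -/
lemma Connected.dist_le_toNat_eccent [Finite V] {G : SimpleGraph V} (hG : G.Connected) (u v : V) :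
    G.dist u v ≤ (G.eccent u).toNat := by
  have : Nonempty V := ⟨u⟩
  refine ENat.toNat_le_toNat edist_le_eccent ?_
  exact ne_top_of_le_ne_top (connected_iff_ediam_ne_top.1 hG) eccent_le_ediam

lemma toNat_eccent_le_of_forall_edist_le {G : SimpleGraph V} {u : V} {k : ℕ}
    (h : ∀ v, G.edist u v ≤ k) : (G.eccent u).toNat ≤ k :=
  ENat.toNat_le_of_le_natCast ((eccent_le_iff u k).2 h)

open scoped Classical in
lemma eccentricConnectivityIndex_eq_sum_sum [Fintype V] (G : SimpleGraph V) :
    eccentricConnectivityIndex G =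
      ∑ x, ∑ y, if G.Adj x y then (G.eccent x).toNat else 0 := by
  unfold eccentricConnectivityIndex
  refine Finset.sum_congr rfl fun x _ => ?_
  rw [← Finset.sum_filter, Finset.sum_const, smul_eq_mul, mul_comm, ← card_neighborFinset_eq_degree,
    neighborFinset_eq_filter]

open scoped Classical in
/-- The sum over the darts of a graph, split along a parent function `p` which decreases the
function `a`. -/
lemma sum_sum_adj_eq_of_parent [Fintype V] (G : SimpleGraph V) (e a : V → ℕ) (p : V → V) (r : V)
    (hp : ∀ v, v ≠ r → G.Adj v (p v)) (ha : ∀ v, v ≠ r → a (p v) < a v) :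
    ∑ x, ∑ y, (if G.Adj x y then e x else 0) =
      ∑ v with v ≠ r, (e v + e (p v)) +
        ∑ z : V × V with G.Adj z.1 z.2 ∧ ¬ (z.1 ≠ r ∧ p z.1 = z.2) ∧ ¬ (z.2 ≠ r ∧ p z.2 = z.1),
          e z.1 := by
  have h1 : ∑ v with v ≠ r, e v =
      ∑ z : V × V with G.Adj z.1 z.2 ∧ (z.1 ≠ r ∧ p z.1 = z.2), e z.1 := by
    refine Finset.sum_bij (fun v _ => (v, p v)) ?_ ?_ ?_ ?_
    · intro v hv
      have hv : v ≠ r := by simpa using hv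
      simpa [hv] using hp v hv
    · intro v _ w _ h
      exact congrArg Prod.fst h
    · rintro ⟨x, y⟩ h
      simp only [Finset.mem_filter, Finset.mem_univ, true_and] at h
      exact ⟨x, by simpa using h.2.1, by simp [h.2.2]⟩
    · intro v _; rfl
  have h2 : ∑ v with v ≠ r, e (p v) =
      ∑ z : V × V with G.Adj z.1 z.2 ∧ ¬ (z.1 ≠ r ∧ p z.1 = z.2) ∧ (z.2 ≠ r ∧ p z.2 = z.1),
        e z.1 := by
    refine Finset.sum_bij (fun v _ => (p v, v)) ?_ ?_ ?_ ?_
    · intro v hv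
      have hv : v ≠ r := by simpa using hv
      simp only [Finset.mem_filter, Finset.mem_univ, true_and]
      refine ⟨(hp v hv).symm, ?_, hv, trivial⟩
      -- Two vertices cannot be each other's parent, since `a` decreases towards the parent.
      rintro ⟨h, h'⟩
      have h3 := ha _ h
      have h4 := ha _ hv
      rw [h'] at h3
      omega
    · intro v _ w _ h
      exact congrArg Prod.snd h
    · rintro ⟨x, y⟩ h
      simp only [Finset.mem_filter, Finset.mem_univ, true_and] at h
      exact ⟨y, by simpa using h.2.2.1, by simp [h.2.2.2]⟩
    · intro v _; rfl
  rw [Finset.sum_add_distrib, h1, h2, ← Fintype.sum_prod_type']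
  simp only [Finset.sum_filter]
  rw [← Finset.sum_add_distrib, ← Finset.sum_add_distrib]
  refine Finset.sum_congr rfl fun z _ => ?_
  have h : ∀ (A B C : Prop) (k : ℕ), (if A then k else 0) =
      (if A ∧ B then k else 0) + (if A ∧ ¬ B ∧ C then k else 0) +
        if A ∧ ¬ B ∧ ¬ C then k else 0 := by
    intro A B C k
    by_cases A <;> by_cases B <;> by_cases C <;> simp [*]
  convert h _ _ _ _

open scoped Classical in
/-- Let `p` be a parent function towards `s`, and let `t` be at distance `d` from `s`. A vertex of
eccentricity at most `r = ⌈d / 2⌉` which is not an ancestor of `t` is an ancestor, in fewer than `r`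
steps, of the start of a dart outside the tree of `p`. -/
lemma card_le_mul_card_nontree_darts [Fintype V] {G : SimpleGraph V} (hG : G.Connected) {s t : V}
    {d r : ℕ} (hst : G.dist s t = d) (hr : 2 * r ≤ d + 1) (p : V → V)
    (hp : ∀ v, v ≠ s → G.Adj v (p v) ∧ G.dist s (p v) + 1 = G.dist s v) (W : Finset V)
    (hWe : ∀ w ∈ W, (G.eccent w).toNat ≤ r) (hW : ∀ w ∈ W, ∀ i ≤ d, p^[i] t ≠ w) :
    W.card ≤ (Finset.card {z : V × V | G.Adj z.1 z.2 ∧ ¬ (z.1 ≠ s ∧ p z.1 = z.2) ∧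
      ¬ (z.2 ≠ s ∧ p z.2 = z.1)}) * r := by
  have hq : ∀ v, ∃ w, v ≠ t → G.Adj v w ∧ G.dist t w + 1 = G.dist t v := by
    intro v
    by_cases h : v = t
    · exact ⟨v, fun h' => absurd h h'⟩
    · obtain ⟨w, hw⟩ := hG.exists_adj_dist_add_one (Ne.symm h)
      exact ⟨w, fun _ => hw⟩
  choose q hq using hq
  set N : Finset (V × V) := {z : V × V | G.Adj z.1 z.2 ∧ ¬ (z.1 ≠ s ∧ p z.1 = z.2) ∧
      ¬ (z.2 ≠ s ∧ p z.2 = z.1)}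
  have hsub : W ⊆ (N ×ˢ Finset.range r).image fun z => p^[z.2] z.1.1 := by
    intro w hw
    have hws : G.dist s w ≤ r := by
      rw [dist_comm]
      exact (hG.dist_le_toNat_eccent w s).trans (hWe w hw)
    have hwt : G.dist t w ≤ r := by
      rw [dist_comm]
      exact (hG.dist_le_toNat_eccent w t).trans (hWe w hw)
    have hdist : ∀ i, i ≤ G.dist t w → G.dist t (q^[i] w) + i = G.dist t w := by
      intro i
      induction i with
      | zero => simp
      | succ i ih =>
        intro hi
        have h1 := ih (by omega)
        have hne : q^[i] w ≠ t := by
          intro h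
          rw [h, dist_self] at h1
          omega
        have h2 := (hq _ hne).2
        rw [Function.iterate_succ_apply']
        omega
    by_contra hcon
    -- Follow the geodesic from `w` to `t` given by `q`. If every step went from parent to child,
    -- `w` would be an ancestor of `t`; the first step that does not is the required non-tree dart.
    have key : ∀ i, i ≤ G.dist t w → p^[i] (q^[i] w) = w ∧
        (0 < i → q^[i] w ≠ s ∧ p (q^[i] w) = q^[i - 1] w) := by
      intro i
      induction i with
      | zero => simp
      | succ i ih =>
        intro hi
        obtain ⟨h1, h2⟩ := ih (by omega)
        have hb := hdist i (by omega)
        have hb' := hdist (i + 1) hi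
        have hne : q^[i] w ≠ t := by
          intro h
          rw [h, dist_self] at hb
          omega
        have hadj := (hq _ hne).1
        rw [← Function.iterate_succ_apply' q i w] at hadj
        have hstep : q^[i + 1] w ≠ s ∧ p (q^[i + 1] w) = q^[i] w := by
          by_contra hnot
          refine hcon (Finset.mem_image.2 ⟨((q^[i] w, q^[i + 1] w), i), ?_, h1⟩)
          simp only [N, Finset.mem_product, Finset.mem_filter, Finset.mem_univ, true_and,
            Finset.mem_range]
          refine ⟨⟨hadj, ?_, hnot⟩, by omega⟩
          rintro ⟨h3, h4⟩
          -- The step cannot go from child to parent either. At the first step it would bring `w`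
          -- closer to both `s` and `t`, giving d ≤ 2r - 2; later, it would return to the previous
          -- vertex of the geodesic.
          rcases Nat.eq_zero_or_pos i with rfl | hi0
          · simp only [Function.iterate_zero, id_eq, zero_add] at h3 h4 hb'
            have h5 := (hp _ h3).2
            rw [h4] at h5
            have h6 := hG.dist_triangle (u := s) (v := q^[1] w) (w := t)
            rw [dist_comm (u := q^[1] w) (v := t)] at h6
            omega
          · have h5 := (h2 hi0).2
            have h6 := hdist (i - 1) (by omega)
            rw [← h5, h4] at h6
            omega
        refine ⟨?_, fun _ => by simpa using hstep⟩
        rw [Function.iterate_succ_apply p, hstep.2, h1]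
    have h1 := (key (G.dist t w) le_rfl).1
    have h2 := hdist (G.dist t w) le_rfl
    have h3 : t = q^[G.dist t w] w := hG.dist_eq_zero_iff.1 (by omega)
    rw [← h3] at h1
    exact hW w hw _ (by omega) h1
  calc W.card ≤ _ := Finset.card_le_card hsub
    _ ≤ _ := Finset.card_image_le
    _ = _ := by rw [Finset.card_product, Finset.card_range]

open scoped Classical in
lemma le_eccentricConnectivityIndex [Fintype V] {G : SimpleGraph V} (hG : G.Connected) {s t : V}
    {d : ℕ} (hst : G.dist s t = d) :
    ∑ i ∈ Finset.range d, (max (i + 1) (d - (i + 1)) + max i (d - i)) +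
      (Fintype.card V - d - 1) * (2 * ((d + 1) / 2) + 1) ≤ eccentricConnectivityIndex G := by
  set r := (d + 1) / 2 with hr
  set e : V → ℕ := fun v => (G.eccent v).toNat with he
  have hp : ∀ v, ∃ w, v ≠ s → G.Adj v w ∧ G.dist s w + 1 = G.dist s v := by
    intro v
    by_cases h : v = s
    · exact ⟨v, fun h' => absurd h h'⟩
    · obtain ⟨w, hw⟩ := hG.exists_adj_dist_add_one (Ne.symm h)
      exact ⟨w, fun _ => hw⟩
  choose p hp using hp
  have hes : ∀ v, G.dist s v ≤ e v := fun v => by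
    rw [dist_comm]; exact hG.dist_le_toNat_eccent v s
  have het : ∀ v, d - G.dist s v ≤ e v := fun v => by
    have h1 := hG.dist_le_toNat_eccent v t
    have h2 := hG.dist_triangle (u := s) (v := v) (w := t)
    simp only [he]
    omega
  have her : ∀ v, r ≤ e v := fun v => by
    have h1 := hes v
    have h2 := het v
    omega
  -- The branch from `s` to `t`, indexed by distance from `s`.
  set u : ℕ → V := fun i => p^[d - i] t with hu
  have hdu : ∀ j, j ≤ d → G.dist s (p^[j] t) + j = d := by
    intro j
    induction j with
    | zero => simp [hst]
    | succ j ih =>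
      intro hj
      have h1 := ih (by omega)
      have hne : p^[j] t ≠ s := by
        intro h
        rw [h, dist_self] at h1
        omega
      have h2 := (hp _ hne).2
      rw [Function.iterate_succ_apply']
      omega
  have hau : ∀ i, i ≤ d → G.dist s (u i) = i := fun i hi => by
    have := hdu (d - i) (by omega)
    simp only [hu]
    omega
  have hpu : ∀ i, i < d → p (u (i + 1)) = u i := fun i hi => by
    simp only [hu]
    rw [← Function.iterate_succ_apply' p, show (d - (i + 1)).succ = d - i by omega]
  have heu : ∀ i, i ≤ d → max i (d - i) ≤ e (u i) := fun i hi => by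
    have h1 := hes (u i)
    have h2 := het (u i)
    rw [hau i hi] at h1 h2
    exact max_le h1 h2
  have hu0 : u 0 = s := (hG.dist_eq_zero_iff.1 (hau 0 (by omega))).symm
  have huinj : Set.InjOn u (Finset.range (d + 1)) := by
    intro i hi j hj hij
    have hi := hau i (by simpa [Nat.lt_succ_iff] using hi)
    have hj := hau j (by simpa [Nat.lt_succ_iff] using hj)
    rw [← hi, hij, hj]
  set P : Finset V := (Finset.range (d + 1)).image u with hP
  set P' : Finset V := (Finset.range d).image fun i => u (i + 1) with hP'
  have hmem : ∀ v, v ∈ P ↔ v = s ∨ v ∈ P' := by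
    intro v
    simp only [hP, hP', Finset.mem_image, Finset.mem_range]
    constructor
    · rintro ⟨i, hi, rfl⟩
      cases i with
      | zero => exact Or.inl hu0
      | succ i => exact Or.inr ⟨i, by omega, rfl⟩
    · rintro (rfl | ⟨i, hi, rfl⟩)
      · exact ⟨0, by omega, hu0⟩
      · exact ⟨i + 1, by omega, rfl⟩
  have hsP' : s ∉ P' := by
    simp only [hP', Finset.mem_image, Finset.mem_range, not_exists, not_and]
    intro i hi h
    have h1 := hau (i + 1) (by omega)
    rw [h, dist_self] at h1
    omega
  have hsplit : (Finset.univ.filter fun v => v ≠ s) = P' ∪ Pᶜ := by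
    ext v
    have h1 := hmem v
    simp only [Finset.mem_filter, Finset.mem_univ, true_and, Finset.mem_union, Finset.mem_compl]
    have h2 : v = s → v ∉ P' := by rintro rfl; exact hsP'
    tauto
  have hdisj : Disjoint P' Pᶜ := by
    refine Finset.disjoint_left.2 fun v hv hv' => ?_
    exact Finset.mem_compl.1 hv' ((hmem v).2 (Or.inr hv))
  have hcard : Pᶜ.card = Fintype.card V - d - 1 := by
    rw [Finset.card_compl, hP, Finset.card_image_of_injOn huinj, Finset.card_range]
    omega
  have hpath : ∑ i ∈ Finset.range d, (max (i + 1) (d - (i + 1)) + max i (d - i)) ≤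
      ∑ v ∈ P', (e v + e (p v)) := by
    rw [hP', Finset.sum_image]
    · refine Finset.sum_le_sum fun i hi => ?_
      have hi := Finset.mem_range.1 hi
      rw [hpu i hi]
      exact add_le_add (heu _ (by omega)) (heu _ (by omega))
    · intro i hi j hj hij
      have hi : i < d := by simpa using hi
      have hj : j < d := by simpa using hj
      have : i + 1 = j + 1 := huinj (by simpa using hi) (by simpa using hj) hij
      omega
  set N : Finset (V × V) := {z : V × V | G.Adj z.1 z.2 ∧ ¬ (z.1 ≠ s ∧ p z.1 = z.2) ∧
      ¬ (z.2 ≠ s ∧ p z.2 = z.1)} with hN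
  -- The last term counts the off-branch vertices that may fall short by 1.
  have hoff : Pᶜ.card * (2 * r + 1) ≤
      ∑ v ∈ Pᶜ, (e v + e (p v)) + (Pᶜ.filter fun v => e v ≤ r).card := by
    rw [Finset.card_filter, ← Finset.sum_add_distrib, ← smul_eq_mul, ← Finset.sum_const]
    refine Finset.sum_le_sum fun v _ => ?_
    have h1 := her v
    have h2 := her (p v)
    split_ifs <;> omega
  have hW : (Pᶜ.filter fun v => e v ≤ r).card ≤ N.card * r := by
    refine card_le_mul_card_nontree_darts hG hst (by omega) p hp _ ?_ ?_
    · intro w hw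
      exact (Finset.mem_filter.1 hw).2
    · intro w hw i hi h
      refine Finset.mem_compl.1 (Finset.mem_filter.1 hw).1 (Finset.mem_image.2 ⟨d - i, ?_, ?_⟩)
      · exact Finset.mem_range.2 (by omega)
      · simp only [hu]
        rw [← h, show d - (d - i) = i by omega]
  have hNsum : N.card * r ≤ ∑ z ∈ N, e z.1 := by
    rw [← smul_eq_mul, ← Finset.sum_const]
    exact Finset.sum_le_sum fun z _ => her z.1
  rw [eccentricConnectivityIndex_eq_sum_sum,
    sum_sum_adj_eq_of_parent G e (G.dist s) p s (fun v hv => (hp v hv).1)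
      (fun v hv => by have := (hp v hv).2; omega),
    hsplit, Finset.sum_union hdisj, ← hcard]
  refine le_trans (b := ∑ v ∈ P', (e v + e (p v)) + ∑ v ∈ Pᶜ, (e v + e (p v)) + ∑ z ∈ N, e z.1)
    (by omega) (le_of_eq ?_)
  congr!

end SimpleGraph
-- Distances and centre of a path
namespace SimpleGraph

lemma pathGraph_edist_le_of_le {n : ℕ} {i j : Fin n} (h : i ≤ j) :
    (pathGraph n).edist i j ≤ (j - i : ℕ) := by
  obtain ⟨k, hk⟩ : ∃ k : ℕ, (j : ℕ) = i + k := ⟨j - i, by have := Fin.le_def.1 h; omega⟩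
  rw [hk, Nat.add_sub_cancel_left]
  clear h
  induction k generalizing j with
  | zero =>
    have : i = j := Fin.ext (by omega)
    simp [this]
  | succ k ih =>
    have hadj : (pathGraph n).Adj (⟨i + k, by omega⟩ : Fin n) j := by
      rw [pathGraph_adj]
      left
      simp only [hk]
      omega
    refine (SimpleGraph.edist_triangle (v := ⟨i + k, by omega⟩)).trans ?_
    rw [Nat.cast_add]
    exact add_le_add (ih (j := ⟨i + k, by omega⟩) rfl) (edist_eq_one_iff_adj.2 hadj).le

lemma pathGraph_edist_le {n : ℕ} (i j : Fin n) :
    (pathGraph n).edist i j ≤ (max (j - i) (i - j) : ℕ) := by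
  rcases le_total i j with h | h
  · exact (pathGraph_edist_le_of_le h).trans (by exact_mod_cast le_max_left _ _)
  · rw [SimpleGraph.edist_comm]
    exact (pathGraph_edist_le_of_le h).trans (by exact_mod_cast le_max_right _ _)

lemma Walk.pathGraph_le_add_length {n : ℕ} {i j : Fin n} (p : (pathGraph n).Walk i j) :
    (i : ℕ) ≤ j + p.length := by
  induction p with
  | nil => simp
  | cons h p ih =>
    rw [pathGraph_adj] at h
    rw [Walk.length_cons]
    omega

lemma pathGraph_le_add_of_edist_le {n k : ℕ} {i j : Fin n} (h : (pathGraph n).edist i j ≤ k) :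
    (i : ℕ) ≤ j + k := by
  obtain ⟨p, hp⟩ := exists_walk_of_edist_ne_top (ne_top_of_le_ne_top (ENat.natCast_ne_top k) h)
  rw [← hp] at h
  have h1 : p.length ≤ k := by exact_mod_cast h
  have h2 := p.pathGraph_le_add_length
  omega

/-- A central vertex is no more eccentric than the middle vertex ⌈d/2⌉; compare its distances to the
two ends. -/
lemma pathGraph_center_bounds {d : ℕ} (c : (pathGraph (d + 1)).center) :
    ((c : Fin (d + 1)) : ℕ) ≤ (d + 1) / 2 ∧ d ≤ (c : Fin (d + 1)) + (d + 1) / 2 := by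
  have h : ∀ j, (pathGraph (d + 1)).edist c j ≤ ((d + 1) / 2 : ℕ) := by
    rw [← eccent_le_iff, (mem_center_iff _).1 c.2]
    refine radius_le_eccent.trans
      ((eccent_le_iff (⟨(d + 1) / 2, by omega⟩ : Fin (d + 1)) _).2 fun j => ?_)
    refine (pathGraph_edist_le _ _).trans ?_
    have := j.2
    exact_mod_cast max_le (by simp only; omega) (by simp only; omega)
  constructor
  · simpa using pathGraph_le_add_of_edist_le (h 0)
  · have := h (Fin.last d)
    rw [SimpleGraph.edist_comm] at this
    simpa using pathGraph_le_add_of_edist_le this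

/-! ### Upper bound for volcano graphs -/

section Volcano

variable {d m : ℕ} {c : Fin m → (pathGraph (d + 1)).center}

@[simp] lemma volcanoGraph_adj_inl_inl {i j : Fin (d + 1)} :
    (volcanoGraph d m c).Adj (Sum.inl i) (Sum.inl j) ↔ (pathGraph (d + 1)).Adj i j := by
  simp only [volcanoGraph, fromRel_adj, ne_eq, Sum.inl.injEq]
  constructor
  · rintro ⟨_, h | h⟩
    exacts [h, h.symm]
  · exact fun h => ⟨h.ne, Or.inl h⟩

@[simp] lemma volcanoGraph_adj_inl_inr {i : Fin (d + 1)} {s : Fin m} :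
    (volcanoGraph d m c).Adj (Sum.inl i) (Sum.inr s) ↔ (c s : Fin (d + 1)) = i := by
  simp [volcanoGraph, fromRel_adj]

@[simp] lemma volcanoGraph_adj_inr_inl {i : Fin (d + 1)} {s : Fin m} :
    (volcanoGraph d m c).Adj (Sum.inr s) (Sum.inl i) ↔ (c s : Fin (d + 1)) = i := by
  rw [adj_comm, volcanoGraph_adj_inl_inr]

@[simp] lemma volcanoGraph_adj_inr_inr {s t : Fin m} :
    ¬ (volcanoGraph d m c).Adj (Sum.inr s) (Sum.inr t) := by
  simp [volcanoGraph, fromRel_adj]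

lemma volcanoGraph_edist_inl_inl_le (i j : Fin (d + 1)) :
    (volcanoGraph d m c).edist (Sum.inl i) (Sum.inl j) ≤ (max (j - i) (i - j) : ℕ) := by
  let f : pathGraph (d + 1) →g volcanoGraph d m c := ⟨Sum.inl, fun h => volcanoGraph_adj_inl_inl.2 h⟩
  obtain ⟨p, hp⟩ := (pathGraph_connected d).exists_walk_length_eq_edist i j
  refine le_trans ?_ (hp.le.trans (pathGraph_edist_le i j))
  rw [← Walk.length_map f]
  exact edist_le _

lemma volcanoGraph_edist_inr_inl_le (s : Fin m) (j : Fin (d + 1)) :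
    (volcanoGraph d m c).edist (Sum.inr s) (Sum.inl j) ≤
      (1 + max ((j : ℕ) - (c s : Fin (d + 1))) (((c s : Fin (d + 1)) : ℕ) - j) : ℕ) := by
  refine (SimpleGraph.edist_triangle (v := Sum.inl (c s : Fin (d + 1)))).trans ?_
  rw [Nat.cast_add]
  exact add_le_add (edist_eq_one_iff_adj.2 (volcanoGraph_adj_inr_inl.2 rfl)).le
    (volcanoGraph_edist_inl_inl_le _ _)

/-- For d ≥ 2 a central vertex is not an end of the path, so pendant vertices are never farther away
than the farther end. -/
lemma volcanoGraph_eccent_inl_le (hd : 2 ≤ d) (i : Fin (d + 1)) :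
    ((volcanoGraph d m c).eccent (Sum.inl i)).toNat ≤ max (i : ℕ) (d - i) := by
  refine toNat_eccent_le_of_forall_edist_le ?_
  have hi := i.2
  rintro (j | s)
  · refine (volcanoGraph_edist_inl_inl_le i j).trans ?_
    have := j.2
    norm_cast
    omega
  · rw [SimpleGraph.edist_comm]
    refine (volcanoGraph_edist_inr_inl_le s i).trans ?_
    have := pathGraph_center_bounds (c s)
    norm_cast
    omega

lemma volcanoGraph_eccent_inr_le (hd : 2 ≤ d) (s : Fin m) :
    ((volcanoGraph d m c).eccent (Sum.inr s)).toNat ≤ (d + 1) / 2 + 1 := by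
  refine toNat_eccent_le_of_forall_edist_le ?_
  have hs := pathGraph_center_bounds (c s)
  rintro (j | t)
  · refine (volcanoGraph_edist_inr_inl_le s j).trans ?_
    have := j.2
    norm_cast
    omega
  -- The two attachment vertices coincide or, for odd d ≥ 3, may be adjacent; either way the
  -- distance is at most r + 1.
  · refine (SimpleGraph.edist_triangle (v := Sum.inl (c t : Fin (d + 1)))).trans ?_
    have h1 := edist_eq_one_iff_adj.2 (volcanoGraph_adj_inl_inr (c := c) (i := c t) (s := t) |>.2 rfl)
    rw [h1]
    refine (add_le_add_left (volcanoGraph_edist_inr_inl_le s _) _).trans ?_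
    have := pathGraph_center_bounds (c t)
    norm_cast
    omega

open scoped Classical in
lemma sum_sum_pathGraph_adj (f : ℕ → ℕ) :
    ∑ i : Fin (d + 1), ∑ j : Fin (d + 1), (if (pathGraph (d + 1)).Adj i j then f i else 0) =
      ∑ i ∈ Finset.range d, (f (i + 1) + f i) := by
  have h : ∀ i j : Fin (d + 1), (if (pathGraph (d + 1)).Adj i j then f i else 0) =
      (if (j : ℕ) + 1 = i then f i else 0) + if (i : ℕ) + 1 = j then f i else 0 := by
    intro i j
    simp only [pathGraph_adj]
    split_ifs <;> omega
  simp only [h, Finset.sum_add_distrib]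
  congr 1
  · rw [Fin.sum_univ_succ]
    simp only [Fin.val_zero, Nat.succ_ne_zero, if_false, Finset.sum_const_zero, zero_add,
      Fin.val_succ, add_left_inj]
    rw [← Fin.sum_univ_eq_sum_range (fun i => f (i + 1))]
    refine Finset.sum_congr rfl fun i _ => ?_
    rw [Finset.sum_eq_single i.castSucc] <;> simp +contextual [Fin.ext_iff]
  · rw [Fin.sum_univ_castSucc, Finset.sum_eq_zero (s := Finset.univ) (f := fun j : Fin (d + 1) =>
      if ((Fin.last d : Fin (d + 1)) : ℕ) + 1 = j then f (Fin.last d : Fin (d + 1)) else 0)]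
    · rw [add_zero, ← Fin.sum_univ_eq_sum_range]
      refine Finset.sum_congr rfl fun i _ => ?_
      rw [Finset.sum_eq_single i.succ] <;> simp +contextual [Fin.ext_iff, eq_comm]
    · intro j _
      have := j.2
      rw [Fin.val_last, if_neg (by omega)]

lemma eccentricConnectivityIndex_volcanoGraph_le (hd : 2 ≤ d) :
    eccentricConnectivityIndex (volcanoGraph d m c) ≤
      ∑ i ∈ Finset.range d, (max (i + 1) (d - (i + 1)) + max i (d - i)) +
        m * (2 * ((d + 1) / 2) + 1) := by
  classical
  rw [eccentricConnectivityIndex_eq_sum_sum]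
  simp only [Fintype.sum_sum_type, volcanoGraph_adj_inl_inl, volcanoGraph_adj_inl_inr,
    volcanoGraph_adj_inr_inl, volcanoGraph_adj_inr_inr, if_false, Finset.sum_const_zero, add_zero,
    Finset.sum_add_distrib]
  rw [← Finset.sum_add_distrib, Finset.sum_add_distrib, add_assoc]
  refine add_le_add ?_ ?_
  · rw [← Finset.sum_add_distrib, ← sum_sum_pathGraph_adj fun i => max i (d - i)]
    refine Finset.sum_le_sum fun i _ => Finset.sum_le_sum fun j _ => ?_
    have := volcanoGraph_eccent_inl_le (c := c) hd i
    split_ifs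
    exacts [this, le_rfl]
  · rw [add_comm, Finset.sum_comm, ← Finset.sum_add_distrib]
    simp only [Finset.sum_ite_eq, Finset.mem_univ, if_true]
    have h : ∀ s, ((volcanoGraph d m c).eccent (Sum.inl (c s : Fin (d + 1)))).toNat +
        ((volcanoGraph d m c).eccent (Sum.inr s)).toNat ≤ 2 * ((d + 1) / 2) + 1 := by
      intro s
      have h1 := volcanoGraph_eccent_inl_le (c := c) hd (c s : Fin (d + 1))
      have h2 := volcanoGraph_eccent_inr_le (c := c) hd s
      have h3 := pathGraph_center_bounds (c s)
      omega
    exact (Finset.sum_le_sum fun s _ => h s).trans (by simp)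

end Volcano

end SimpleGraph

theorem theorem2 {V : Type*} [Fintype V] (G : SimpleGraph V) (n d : ℕ)
    (hG : G.Connected) (hn : Fintype.card V = n) (hdiam : G.diam = d) (hd : 2 ≤ d)
    (c : Fin (n - d - 1) → (SimpleGraph.pathGraph (d + 1)).center) :
    eccentricConnectivityIndex (volcanoGraph d (n - d - 1) c) ≤ eccentricConnectivityIndex G := by
  have := hG.nonempty
  obtain ⟨s, t, hst⟩ := G.exists_dist_eq_diam
  subst hn
  exact (SimpleGraph.eccentricConnectivityIndex_volcanoGraph_le hd).trans
    (SimpleGraph.le_eccentricConnectivityIndex hG (hst.trans hdiam))
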